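/- Let $K$ be a nonzero commutative ring with unit, $\lambda\in K$, and let $X$ be a set. All algebras below are associative $K$-algebras, not necessarily unital. A Rota--Baxter algebra of weight $\lambda$ is an algebra $R$ with a $K$-linear operator $P:R\to R$ such that $P(x)P(y)=P\big(P(x)y+xP(y)+\lambda xy\big)$ for all $x,y\in R$. Let $S(X)$ be the free semigroup (without unit) on $X$, let $X^*$ be the free monoid on $X$, and let $\mathfrak S(X)=\bigcup_{n\ge 0}\mathfrak S_n$, where $\mathfrak S_0=S(X)$ and $\mathfrak S_{n}=S(X\cup P(\mathfrak S_{n-1}))$; that is, $\mathfrak S(X)$ is the semigroup of words in the letters of $X$ and one unary operator symbol $P$. Let $K\langle X;P\rangle$ be the $K$-algebra with $K$-basis $\mathfrak S(X)$, with the operator $P$ extended linearly, and let $$S=\{P(x)P(y)-P(P(x)y)-P(xP(y))-\lambda P(xy)\mid x,y\in\mathfrak S(X)\}.$$ Let $Id(S)$ be the smallest two-sided ideal and $K$-submodule of $K\langle X;P\rangle$ that contains $S$ and is closed under $P$, and let $K\langle X;P|S\rangle=K\langle X;P\rangle/Id(S)$, with the induced operator $P$. Given a well ordering of $X$, write each $u\in\mathfrak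 S(X)$ uniquely as $u=u_0P(b_1)u_1\cdots P(b_t)u_t$ with $u_i\in X^*$ and $b_i\in\mathfrak S(X)$, and order $\mathfrak S(X)$ recursively by comparing the weights $(t,b_1,\dots,b_t,u_0,\dots,u_t)$ lexicographically, where words of $X^*$ are compared by the deg-lex ordering. For $s\in S$ let $\bar s$ be the leading (greatest) word of $s$. A $\star$-word is an element $q\in\mathfrak S(X\cup\{\star\})$ with exactly one occurrence of $\star$, and $q|_v$ is the word obtained from it by replacing $\star$ by $v\in\mathfrak S(X)$. Put $$Irr(S)=\{w\in\mathfrak S(X)\mid w\ne q|_{\bar s}\text{ for all }\star\text{-words }q\text{ and all }s\in S\}.$$ For $Y,Z\subseteq\mathfrak S(X)$ let $$\Lambda(Y,Z)=\bigcup_{r\ge1}(YP(Z))^r\cup\bigcup_{r\ge0}(YP(Z))^rY\cup\bigcup_{r\ge1}(P(Z)Y)^r\cup\bigcup_{r\ge0}(P(Z)Y)^rP(Z).$$ Put $\Phi_0=S(X)$, $\Phi_n=\Lambda(\Phi_0,\Phi_{n-1})$ for $n>0$, and $\Phi(X)=\bigcup_{n\ge0}\Phi_n$. Then: (1) $Irr(S)=\Phi(X)$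 for every well ordering of $X$; (2) the images of the elements of $\Phi(X)$ in $K\langle X;P|S\rangle$ form a $K$-basis of $K\langle X;P|S\rangle$ (distinct elements of $\Phi(X)$ having distinct images); (3) $K\langle X;P|S\rangle$ with its operator $P$ is a free Rota--Baxter algebra of weight $\lambda$ on $X$: it is a Rota--Baxter algebra of weight $\lambda$, and for every Rota--Baxter algebra $(A,Q)$ of weight $\lambda$ and every map $f:X\to A$ there is a unique homomorphism of $K$-algebras $\varphi:K\langle X;P|S\rangle\to A$ such that $\varphi\circ P=Q\circ\varphi$ and $\varphi$ maps the image of each $x\in X$ to $f(x)$. -/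

import Mathlib

open scoped Pointwise

universe u v w

namespace RotaBaxter

/-! ### The free semigroup with one operator -/

/-- The prime words over `X`: the elements of `X ∪ P(𝔖(X))`. A word is a nonempty
product of prime words, i.e. an element of the free semigroup (without unit) on them. -/
inductive PrimeWord (X : Type u) : Type u
  | var (x : X) : PrimeWord X
  | op (w : FreeSemigroup (PrimeWord X)) : PrimeWord X

/-- `𝔖(X)`, the semigroup of all words in the letters `x ∈ X` and one operator symbol `P`. -/
abbrev OpWord (X : Type u) : Type u := FreeSemigroup (PrimeWord X)

namespace OpWord

variable {X : Type u} {Y : Type v}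

/-- The letter `x` as a word. -/
def ofVar (x : X) : OpWord X := FreeSemigroup.of (PrimeWord.var x)

/-- The operation `w ↦ P(w)` on words. -/
def opP (w : OpWord X) : OpWord X := FreeSemigroup.of (PrimeWord.op w)

mutual
  /-- Substitution of the words `f y` for the letters `y`, on a prime word. -/
  def substPrime (f : Y → OpWord X) : PrimeWord Y → OpWord X
    | .var y => f y
    | .op w => opP (subst f w)
  /-- Substitution of the words `f y` for the letters `y`, on a word. -/
  def subst (f : Y → OpWord X) : FreeSemigroup (PrimeWord Y) → OpWord X
    | ⟨a, l⟩ => substList f (substPrime f a) l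
  /-- `w` times the result of the substitution on the (possibly empty) list `l`. -/
  def substList (f : Y → OpWord X) (w : OpWord X) : List (PrimeWord Y) → OpWord X
    | [] => w
    | a :: l => substList f (w * substPrime f a) l
end

mutual
  /-- Number of occurrences of `⋆` (that is, `none`) in a prime word over `X ∪ {⋆}`. -/
  def starCountPrime : PrimeWord (Option X) → ℕ
    | .var none => 1
    | .var (some _) => 0
    | .op w => starCount w
  /-- Number of occurrences of `⋆` in a word over `X ∪ {⋆}`. -/
  def starCount : FreeSemigroup (PrimeWord (Option X)) → ℕ
    | ⟨a, l⟩ => starCountPrime a + starCountList l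
  /-- Number of occurrences of `⋆` in a list of prime words over `X ∪ {⋆}`. -/
  def starCountList : List (PrimeWord (Option X)) → ℕ
    | [] => 0
    | a :: l => starCountPrime a + starCountList l
end

end OpWord

/-- `𝔖^⋆(X)`: the words over `X ∪ {⋆}` with exactly one occurrence of `⋆`. -/
def StarWord (X : Type u) : Type u := {q : OpWord (Option X) // OpWord.starCount q = 1}

/-- `q|_v`: the word obtained from the `⋆`-word `q` on replacing `⋆` by the word `v`. -/
def StarWord.plug {X : Type u} (q : StarWord X) (v : OpWord X) : OpWord X :=
  OpWord.subst (fun o : Option X => o.elim v OpWord.ofVar) q.1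

/-! ### The ordering of words -/

namespace OpWord

variable {X : Type u}

/-- For `l = u₀ P(b₁) u₁ ⋯ P(bₜ) uₜ` with `uᵢ ∈ X^*`, the list `b₁, …, bₜ`. -/
def argsList : List (PrimeWord X) → List (OpWord X)
  | [] => []
  | .var _ :: l => argsList l
  | .op b :: l => b :: argsList l

/-- For `l = u₀ P(b₁) u₁ ⋯ P(bₜ) uₜ` with `uᵢ ∈ X^*`, the nonempty list `u₀, …, uₜ`,
as the pair of its first entry `u₀` and of the list `u₁, …, uₜ`. -/
def blocksAux : List (PrimeWord X) → List X × List (List X)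
  | [] => ([], [])
  | .var x :: l => (x :: (blocksAux l).1, (blocksAux l).2)
  | .op _ :: l => ([], (blocksAux l).1 :: (blocksAux l).2)

/-- For `w = u₀ P(b₁) u₁ ⋯ P(bₜ) uₜ` with `uᵢ ∈ X^*`, the list `b₁, …, bₜ`. -/
def args (w : OpWord X) : List (OpWord X) := argsList (w.head :: w.tail)

/-- For `w = u₀ P(b₁) u₁ ⋯ P(bₜ) uₜ` with `uᵢ ∈ X^*`, the list `u₀, u₁, …, uₜ`. -/
def blocks (w : OpWord X) : List (List X) :=
  (blocksAux (w.head :: w.tail)).1 :: (blocksAux (w.head :: w.tail)).2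

/-- The ordering of `𝔖(X)` attached to a well ordering `r` (`<`) of `X`: the words
`w = u₀ P(b₁) u₁ ⋯ P(bₜ) uₜ` are ordered by comparing the weights
`(t, b₁, …, bₜ, u₀, …, uₜ)` lexicographically, where the `bᵢ` are compared recursively by the
same ordering and the `uᵢ ∈ X^*` by the deg-lex ordering. -/
inductive WtLT (r : X → X → Prop) : OpWord X → OpWord X → Prop
  | count {w₁ w₂ : OpWord X} (h : w₁.args.length < w₂.args.length) : WtLT r w₁ w₂
  | args {w₁ w₂ : OpWord X} (p : List (OpWord X)) (b₁ b₂ : OpWord X) (s₁ s₂ : List (OpWord X))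
      (h₁ : w₁.args = p ++ b₁ :: s₁) (h₂ : w₂.args = p ++ b₂ :: s₂)
      (hs : s₁.length = s₂.length) (h : WtLT r b₁ b₂) : WtLT r w₁ w₂
  | blocks {w₁ w₂ : OpWord X} (h : w₁.args = w₂.args)
      (hb : List.Lex (List.Shortlex r) w₁.blocks w₂.blocks) : WtLT r w₁ w₂

end OpWord

/-! ### The free algebra with one operator, leading words, irreducible words -/

/-- `K⟨X;P⟩`, the (non-unital) associative `K`-algebra spanned by `𝔖(X)`. -/
abbrev OpAlg (K : Type v) (X : Type u) [CommRing K] : Type (max u v) :=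
  MonoidAlgebra K (OpWord X)

namespace OpAlg

variable (K : Type v) {X : Type u} [CommRing K]

/-- A word as an element of `K⟨X;P⟩`. -/
noncomputable def word (a : OpWord X) : OpAlg K X := MonoidAlgebra.single a 1

/-- The linear extension to `K⟨X;P⟩` of the operation `P` on words. -/
noncomputable def opP : OpAlg K X →ₗ[K] OpAlg K X :=
  MonoidAlgebra.mapDomainLinearMap K K OpWord.opP

variable {K}

/-- `a` is the leading word of `f` with respect to the strict ordering `lt` of words. -/
def IsLeadingWord (lt : OpWord X → OpWord X → Prop) (f : OpAlg K X) (a : OpWord X) : Prop :=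
  a ∈ f.coeff.support ∧ ∀ b ∈ f.coeff.support, b ≠ a → lt b a

/-- `Irr(S)`: the words that are not of the form `q|_{s̄}` for a `⋆`-word `q` and the
leading word `s̄` of an element `s` of `S`. -/
def Irr (lt : OpWord X → OpWord X → Prop) (S : Set (OpAlg K X)) : Set (OpWord X) :=
  {a | ∀ (q : StarWord X), ∀ s ∈ S, ∀ b, IsLeadingWord lt s b → a ≠ q.plug b}

/-- An operated ideal of `K⟨X;P⟩`: a two-sided ideal (and `K`-submodule) closed under `P`. -/
structure IsOpIdeal (I : Submodule K (OpAlg K X)) : Prop where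
  mul_left : ∀ a, ∀ b ∈ I, a * b ∈ I
  mul_right : ∀ a ∈ I, ∀ b, a * b ∈ I
  opP_mem : ∀ a ∈ I, opP K a ∈ I

/-- `Id(S)`, the operated ideal of `K⟨X;P⟩` generated by `S`. -/
noncomputable def idSpan (S : Set (OpAlg K X)) : Submodule K (OpAlg K X) :=
  sInf {I | IsOpIdeal I ∧ S ⊆ I}

theorem isOpIdeal_idSpan (S : Set (OpAlg K X)) : IsOpIdeal (idSpan S) where
  mul_left a b hb := by
    simp only [idSpan, Submodule.mem_sInf] at hb ⊢
    exact fun I hI => hI.1.mul_left a b (hb I hI)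
  mul_right a ha b := by
    simp only [idSpan, Submodule.mem_sInf] at ha ⊢
    exact fun I hI => hI.1.mul_right a (ha I hI) b
  opP_mem a ha := by
    simp only [idSpan, Submodule.mem_sInf] at ha ⊢
    exact fun I hI => hI.1.opP_mem a (ha I hI)

end OpAlg

/-! ### The quotient algebra -/

/-- `K⟨X;P|S⟩ = K⟨X;P⟩ / Id(S)`. -/
def OpQuot {K : Type v} {X : Type u} [CommRing K] (S : Set (OpAlg K X)) : Type (max u v) :=
  OpAlg K X ⧸ OpAlg.idSpan S

namespace OpQuot

variable {K : Type v} {X : Type u} [CommRing K] (S : Set (OpAlg K X))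

noncomputable instance : AddCommGroup (OpQuot S) :=
  inferInstanceAs (AddCommGroup (OpAlg K X ⧸ OpAlg.idSpan S))

noncomputable instance : Module K (OpQuot S) :=
  inferInstanceAs (Module K (OpAlg K X ⧸ OpAlg.idSpan S))

/-- The canonical projection `K⟨X;P⟩ → K⟨X;P|S⟩`. -/
noncomputable def mk : OpAlg K X →ₗ[K] OpQuot S := (OpAlg.idSpan S).mkQ

theorem mk_surjective : Function.Surjective (mk S) := (OpAlg.idSpan S).mkQ_surjective

/-- The multiplication of `K⟨X;P|S⟩`, as a bilinear map. -/
noncomputable def mulHom : OpQuot S →ₗ[K] OpQuot S →ₗ[K] OpQuot S :=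
  (OpAlg.idSpan S).liftQ
    (LinearMap.flip ((OpAlg.idSpan S).liftQ
      (LinearMap.flip ((LinearMap.mul K (OpAlg K X)).compr₂ (mk S))) (by
        intro b hb
        rw [LinearMap.mem_ker]
        refine LinearMap.ext fun a => ?_
        exact (Submodule.Quotient.mk_eq_zero _).2
          ((OpAlg.isOpIdeal_idSpan S).mul_left a b hb)))) (by
    intro a ha
    rw [LinearMap.mem_ker]
    refine LinearMap.ext fun y => ?_
    obtain ⟨b, rfl⟩ := mk_surjective S y
    exact (Submodule.Quotient.mk_eq_zero _).2
      ((OpAlg.isOpIdeal_idSpan S).mul_right a ha b))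

noncomputable instance : Mul (OpQuot S) := ⟨fun a b => mulHom S a b⟩

theorem mk_mul (a b : OpAlg K X) : mk S (a * b) = mk S a * mk S b := rfl

noncomputable instance : NonUnitalRing (OpQuot S) where
  left_distrib a b c := (mulHom S a).map_add b c
  right_distrib a b c := LinearMap.map_add₂ (mulHom S) a b c
  zero_mul a := LinearMap.map_zero₂ (mulHom S) a
  mul_zero a := (mulHom S a).map_zero
  mul_assoc a b c := by
    obtain ⟨a, rfl⟩ := mk_surjective S a
    obtain ⟨b, rfl⟩ := mk_surjective S b
    obtain ⟨c, rfl⟩ := mk_surjective S c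
    simp only [← mk_mul, mul_assoc]

instance : IsScalarTower K (OpQuot S) (OpQuot S) :=
  ⟨fun k a b => LinearMap.map_smul₂ (mulHom S) k a b⟩

instance : SMulCommClass K (OpQuot S) (OpQuot S) :=
  ⟨fun k a b => ((mulHom S a).map_smul k b).symm⟩

/-- The operator `P` of `K⟨X;P|S⟩`. -/
noncomputable def opP : OpQuot S →ₗ[K] OpQuot S :=
  (OpAlg.idSpan S).mapQ (OpAlg.idSpan S) (OpAlg.opP K)
    fun a ha => (OpAlg.isOpIdeal_idSpan S).opP_mem a ha

theorem mk_opP (a : OpAlg K X) : mk S (OpAlg.opP K a) = opP S (mk S a) := rfl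

end OpQuot

/-! ### Rota-Baxter algebras and Rota-Baxter words -/

/-- The `K`-linear operator `P` on the (non-unital) associative `K`-algebra `R` makes `R` a
Rota-Baxter algebra of weight `lam`. -/
def IsRotaBaxter {K : Type v} [CommRing K] (lam : K) {R : Type w} [NonUnitalRing R] [Module K R]
    (P : R →ₗ[K] R) : Prop :=
  ∀ x y : R, P x * P y = P (P x * y + x * P y + lam • (x * y))

/-- `R` with the operator `P` and the map `i : X → R` is a free Rota-Baxter algebra of weight
`lam` on the set `X` (tested against algebras in the universe `w`). -/
def IsFreeRotaBaxter {K : Type v} [CommRing K] (lam : K) {X : Type u}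
    {R : Type*} [NonUnitalRing R] [Module K R]
    (P : R →ₗ[K] R) (i : X → R) : Prop :=
  IsRotaBaxter lam P ∧
  ∀ (A : Type w) [NonUnitalRing A] [Module K A] [IsScalarTower K A A] [SMulCommClass K A A]
    (Q : A →ₗ[K] A), IsRotaBaxter lam Q → ∀ f : X → A,
      ∃! φ : R →ₙₐ[K] A, (∀ a, φ (P a) = Q (φ a)) ∧ ∀ x, φ (i x) = f x

/-- The set `S` of the polynomials `P(x)P(y) - P(P(x)y) - P(xP(y)) - λ P(xy)`,
with `x, y ∈ 𝔖(X)`. -/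
def rbRelations {K : Type v} [CommRing K] (lam : K) (X : Type u) : Set (OpAlg K X) :=
  {s | ∃ x y : OpWord X,
    s = OpAlg.word K (x.opP * y.opP) - OpAlg.word K (x.opP * y).opP
      - OpAlg.word K (x * y.opP).opP - lam • OpAlg.word K (x * y).opP}

section Words

variable {X : Type u}

/-- `setPow A n` is the set of all products of `n + 1` elements of `A`. -/
def setPow (A : Set (OpWord X)) : ℕ → Set (OpWord X)
  | 0 => A
  | n + 1 => setPow A n * A

/-- The alternating product of `Y` and `Z` with `P`:
`⋃_{r≥1} (YP(Z))^r ∪ ⋃_{r≥0} (YP(Z))^r Y ∪ ⋃_{r≥1} (P(Z)Y)^r ∪ ⋃_{r≥0} (P(Z)Y)^r P(Z)`,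
with the terms for `r = 0` written separately. -/
def altProd (Y Z : Set (OpWord X)) : Set (OpWord X) :=
  (⋃ n : ℕ, setPow (Y * OpWord.opP '' Z) n) ∪
  (Y ∪ ⋃ n : ℕ, setPow (Y * OpWord.opP '' Z) n * Y) ∪
  (⋃ n : ℕ, setPow (OpWord.opP '' Z * Y) n) ∪
  (OpWord.opP '' Z ∪ ⋃ n : ℕ, setPow (OpWord.opP '' Z * Y) n * OpWord.opP '' Z)

variable (X)

/-- `S(X) ⊆ 𝔖(X)`: the nonempty words in the letters from `X`, without `P`. -/
def varWords : Set (OpWord X) :=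
  Set.range (FreeSemigroup.map (PrimeWord.var : X → PrimeWord X))

/-- `Φ₀ = S(X)` and `Φₙ₊₁` is the alternating product of `Φ₀` and `Φₙ`. -/
def rbWordsAux : ℕ → Set (OpWord X)
  | 0 => varWords X
  | n + 1 => altProd (varWords X) (rbWordsAux n)

/-- `Φ(X) = ⋃ₙ Φₙ`, the set of Rota-Baxter words. -/
def rbWords : Set (OpWord X) := ⋃ n : ℕ, rbWordsAux X n

end Words

end RotaBaxter

-- Both Irr(S) and Φ(X) turn out to be the set of words in which no two factors P(b)P(c) are
-- adjacent at any depth (`NoAdj`). In the relation for a and b the word P(a)P(b) has two top-level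
-- factors P(·) and every other term has one, so it is the leading word, and a word is reducible
-- exactly when some P(a)P(b) occurs in it. On the other side, Φ(X) consists of the words that
-- alternate, at every depth, between blocks of letters and single factors P(·) (`mem_rbWords_iff`).
--
-- The basis is obtained without analysing compositions of relations. Spanning: the Rota-Baxter
-- identity replaces a product P(a)P(b) by P of products of smaller total size, so induction on size
-- reduces everything to `NoAdj` words (`mk_word_mul_mem_wordSpan`). Independence: the module K⟨X;P⟩
-- carries a second product, `diamond`, which concatenates words but applies the identity where the
-- two words meet. It is associative (`diamond_assoc`) and satisfies the Rota-Baxter identity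
-- (`diamond_opP`), so the universal property of the quotient gives a linear map `normalForm` back
-- to K⟨X;P⟩. This map sends the image of each `NoAdj` word to the word itself (`normalForm_word`),
-- and distinct words are independent there.
--
-- Freeness is formal: evaluation of words in a Rota-Baxter algebra has as kernel an operated ideal
-- containing S.

namespace RotaBaxter

namespace OpWord

variable {X : Type u} {Y : Type v}

/-! ### Induction principles for words -/

/-- A word is built from the empty product by appending letters and words of the form `P(c)`. -/
theorem induction_append {p : OpWord X → Prop} (var : ∀ x, p (ofVar x)) (op : ∀ c, p c → p c.opP)
    (mul_var : ∀ a x, p a → p (a * ofVar x)) (mul_op : ∀ a c, p a → p c → p (a * c.opP))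
    (a : OpWord X) : p a := by
  have key : ∀ b : PrimeWord X, p (FreeSemigroup.of b) ∧ ∀ a, p a → p (a * FreeSemigroup.of b) := by
    intro b
    -- Prime words are nested through `FreeSemigroup` and `List`, hence three motives; the one for
    -- lists says that `p` survives appending the list on the right.
    refine PrimeWord.rec
      (motive_1 := fun b => p (FreeSemigroup.of b) ∧ ∀ a, p a → p (a * FreeSemigroup.of b))
      (motive_2 := p) (motive_3 := fun l => ∀ a : OpWord X, p a → p ⟨a.head, a.tail ++ l⟩)
      (fun x => ⟨var x, fun a ha => mul_var a x ha⟩)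
      (fun c hc => ⟨op c hc, fun a ha => mul_op a c ha hc⟩)
      (fun b l hb hl => hl _ hb.1) (fun a ha => by simpa using ha) (fun b l hb hl a ha => ?_) b
    simpa [FreeSemigroup.of] using hl _ (hb.2 a ha)
  obtain ⟨b, l⟩ := a
  suffices h : ∀ (l : List (PrimeWord X)) (a : OpWord X), p a → p ⟨a.head, a.tail ++ l⟩ from
    h l _ (key b).1
  intro l
  induction l with
  | nil => intro a ha; simpa using ha
  | cons c l ih => intro a ha; simpa [FreeSemigroup.of] using ih _ ((key c).2 a ha)

theorem induction_mul {p : OpWord X → Prop} (var : ∀ x, p (ofVar x)) (op : ∀ c, p c → p c.opP)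
    (mul : ∀ a b, p a → p b → p (a * b)) (a : OpWord X) : p a :=
  induction_append var op (fun a x ha => mul a _ ha (var x))
    (fun a c ha hc => mul a _ ha (op c hc)) a

theorem of_mul_mk (a b : PrimeWord X) (l : List (PrimeWord X)) :
    FreeSemigroup.of a * (⟨b, l⟩ : OpWord X) = ⟨a, b :: l⟩ := rfl

/-- Induction on the first letter. -/
theorem induction_cons {p : OpWord X → Prop} (of : ∀ b, p (FreeSemigroup.of b))
    (of_mul : ∀ b a, p a → p (FreeSemigroup.of b * a)) (a : OpWord X) : p a := by
  obtain ⟨b, l⟩ := a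
  induction l generalizing b with
  | nil => exact of b
  | cons c l ih => exact of_mul b _ (ih c)

/-! ### Substitution and `⋆`-words -/

theorem substList_append (f : Y → OpWord X) (a : OpWord X) (l l' : List (PrimeWord Y)) :
    substList f a (l ++ l') = substList f (substList f a l) l' := by
  induction l generalizing a with
  | nil => simp [substList]
  | cons b l ih => simp [substList, ih]

/-- The accumulator stands in for the missing empty product; pulling a left factor out of it is what
makes substitution multiplicative. -/
theorem substList_mul (f : Y → OpWord X) (a b : OpWord X) (l : List (PrimeWord Y)) :
    substList f (a * b) l = a * substList f b l := by
  induction l generalizing b with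
  | nil => simp [substList]
  | cons c l ih => simp [substList, mul_assoc, ih]

@[simp] theorem subst_ofVar (f : Y → OpWord X) (y : Y) : subst f (ofVar y) = f y := by
  simp [ofVar, FreeSemigroup.of, subst, substPrime, substList]

@[simp] theorem subst_opP (f : Y → OpWord X) (a : OpWord Y) :
    subst f a.opP = (subst f a).opP := by
  simp [opP, FreeSemigroup.of, subst, substPrime, substList]

@[simp] theorem subst_mul (f : Y → OpWord X) (a b : OpWord Y) :
    subst f (a * b) = subst f a * subst f b := by
  obtain ⟨a, l⟩ := a
  obtain ⟨b, m⟩ := b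
  change subst f ⟨a, l ++ b :: m⟩ = _
  simp only [subst, substList_append, substList, substList_mul]

theorem subst_subst {Z : Type w} (f : Y → OpWord X) (g : Z → OpWord Y) (a : OpWord Z) :
    subst f (subst g a) = subst (fun z => subst f (g z)) a := by
  induction a using induction_mul with
  | var x => simp
  | op c hc => simp [hc]
  | mul a b ha hb => simp [ha, hb]

theorem subst_id (a : OpWord X) : subst ofVar a = a := by
  induction a using induction_mul with
  | var x => simp
  | op c hc => simp [hc]
  | mul a b ha hb => simp [ha, hb]

theorem starCountList_append (l l' : List (PrimeWord (Option X))) :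
    starCountList (l ++ l') = starCountList l + starCountList l' := by
  induction l with
  | nil => simp [starCountList]
  | cons b l ih => simp [starCountList, ih, add_assoc]

@[simp] theorem starCount_ofVar_none : starCount (ofVar (none : Option X)) = 1 := by
  simp [ofVar, FreeSemigroup.of, starCount, starCountPrime, starCountList]

@[simp] theorem starCount_ofVar_some (x : X) : starCount (ofVar (some x)) = 0 := by
  simp [ofVar, FreeSemigroup.of, starCount, starCountPrime, starCountList]

@[simp] theorem starCount_opP (a : OpWord (Option X)) : starCount a.opP = starCount a := by
  simp [opP, FreeSemigroup.of, starCount, starCountPrime, starCountList]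

@[simp] theorem starCount_mul (a b : OpWord (Option X)) :
    starCount (a * b) = starCount a + starCount b := by
  obtain ⟨a, l⟩ := a
  obtain ⟨b, m⟩ := b
  change starCount ⟨a, l ++ b :: m⟩ = _
  simp only [starCount, starCountList_append, starCountList]
  omega

/-- A word over `X` as a word over `X ∪ {⋆}` without `⋆`. -/
def lift (a : OpWord X) : OpWord (Option X) := subst (fun x => ofVar (some x)) a

@[simp] theorem starCount_lift (a : OpWord X) : starCount (lift a) = 0 := by
  induction a using induction_mul with
  | var x => simp [lift]
  | op c hc => simpa [lift] using hc
  | mul a b ha hb =>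
    simp only [lift] at ha hb
    simp [lift, ha, hb]

@[simp] theorem subst_elim_lift (a b : OpWord X) :
    subst (fun o : Option X => o.elim b ofVar) (lift a) = a := by
  simp [lift, subst_subst, subst_id]

/-- The words `q|_b` for `⋆`-words `q`. -/
def occurrences (b : OpWord X) : Set (OpWord X) := Set.range fun q : StarWord X => q.plug b

theorem mem_occurrences_self (b : OpWord X) : b ∈ occurrences b :=
  ⟨⟨ofVar none, by simp⟩, by simp [StarWord.plug]⟩

theorem opP_mem_occurrences {a b : OpWord X} : a ∈ occurrences b → a.opP ∈ occurrences b := by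
  rintro ⟨⟨q, hq⟩, rfl⟩
  exact ⟨⟨q.opP, by simp [hq]⟩, by simp [StarWord.plug]⟩

theorem mul_left_mem_occurrences {a b : OpWord X} (c : OpWord X) :
    a ∈ occurrences b → c * a ∈ occurrences b := by
  rintro ⟨⟨q, hq⟩, rfl⟩
  exact ⟨⟨lift c * q, by simp [hq]⟩, by simp [StarWord.plug]⟩

theorem mul_right_mem_occurrences {a b : OpWord X} (c : OpWord X) :
    a ∈ occurrences b → a * c ∈ occurrences b := by
  rintro ⟨⟨q, hq⟩, rfl⟩
  exact ⟨⟨q * lift c, by simp [hq]⟩, by simp [StarWord.plug]⟩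

end OpWord

/-! ### Words without two adjacent factors `P(b)P(c)` -/

/-- The prime word is of the form `P(b)`. -/
def PrimeWord.IsOp {X : Type u} : PrimeWord X → Prop
  | .var _ => False
  | .op _ => True

namespace OpWord

variable {X : Type u}

/-- The first factor of the word is of the form `P(b)`. -/
def HeadOp (a : OpWord X) : Prop := a.head.IsOp

/-- The last factor of the word is of the form `P(b)`. -/
def LastOp (a : OpWord X) : Prop := (a.tail.getLastD a.head).IsOp

@[simp] theorem headOp_ofVar (x : X) : ¬ (ofVar x).HeadOp := id
@[simp] theorem lastOp_ofVar (x : X) : ¬ (ofVar x).LastOp := id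
@[simp] theorem headOp_opP (a : OpWord X) : a.opP.HeadOp := trivial
@[simp] theorem lastOp_opP (a : OpWord X) : a.opP.LastOp := trivial
@[simp] theorem lastOp_of (a : PrimeWord X) : LastOp (FreeSemigroup.of a) ↔ a.IsOp := Iff.rfl
@[simp] theorem headOp_mul (a b : OpWord X) : (a * b).HeadOp ↔ a.HeadOp := Iff.rfl
@[simp] theorem lastOp_mul (a b : OpWord X) : (a * b).LastOp ↔ b.LastOp := by
  simp [LastOp, List.getLastD_eq_getLast?, List.getLast?_append, List.getLast?_cons]

mutual
  /-- No two factors `P(b)P(c)` are adjacent at any depth in a prime word. -/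
  def NoAdjPrime : PrimeWord X → Prop
    | .var _ => True
    | .op a => NoAdj a
  /-- No two factors `P(b)P(c)` are adjacent at any depth in a word. -/
  def NoAdj : FreeSemigroup (PrimeWord X) → Prop
    | ⟨a, l⟩ => NoAdjPrime a ∧ NoAdjList a l
  /-- No two factors `P(b)P(c)` are adjacent at any depth in the list `l` preceded by `a`,
  apart from those inside `a`. -/
  def NoAdjList (a : PrimeWord X) : List (PrimeWord X) → Prop
    | [] => True
    | b :: l => ¬ (a.IsOp ∧ b.IsOp) ∧ NoAdjPrime b ∧ NoAdjList b l
end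

theorem noAdj_of (a : PrimeWord X) : NoAdj (FreeSemigroup.of a) ↔ NoAdjPrime a := by
  simp [FreeSemigroup.of, NoAdj, NoAdjList]

@[simp] theorem noAdj_ofVar (x : X) : NoAdj (ofVar x) := by
  simp [ofVar, noAdj_of, NoAdjPrime]

@[simp] theorem noAdj_opP (a : OpWord X) : NoAdj a.opP ↔ NoAdj a := by
  simp [opP, noAdj_of, NoAdjPrime]

-- Only the junction of the two words can create a new adjacent pair. This turns the recursion on
-- lists into a rule for products.
@[simp] theorem noAdj_mul (a b : OpWord X) :
    NoAdj (a * b) ↔ NoAdj a ∧ NoAdj b ∧ ¬ (a.LastOp ∧ b.HeadOp) := by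
  induction a using induction_cons with
  | of a =>
    obtain ⟨b, m⟩ := b
    simp only [of_mul_mk, NoAdj, NoAdjList, noAdj_of, lastOp_of, HeadOp]
    tauto
  | of_mul a c ih =>
    rw [mul_assoc]
    have key : ∀ d : OpWord X, NoAdj (FreeSemigroup.of a * d) ↔
        NoAdjPrime a ∧ NoAdj d ∧ ¬ (a.IsOp ∧ d.HeadOp) := by
      rintro ⟨d, m⟩
      simp only [of_mul_mk, NoAdj, NoAdjList, HeadOp]
      tauto
    rw [key, key, ih]
    simp only [headOp_mul, lastOp_mul]
    tauto

theorem not_noAdj_of_mem_occurrences {a b : OpWord X} (hb : ¬ NoAdj b) :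
    a ∈ occurrences b → ¬ NoAdj a := by
  rintro ⟨⟨q, hq⟩, rfl⟩
  simp only [StarWord.plug]
  induction q using induction_mul with
  | var o => cases o with
    | none => simpa using hb
    | some x => simp at hq
  | op c ih => simpa using ih (by simpa using hq)
  | mul c d hc hd =>
    rw [starCount_mul] at hq
    -- The single `⋆` lies in exactly one of the two factors, and that factor already contains the
    -- forbidden pair after substitution.
    rw [subst_mul, noAdj_mul]
    rcases Nat.eq_zero_or_pos (starCount c) with h | h
    · exact fun h' => hd (by omega) h'.2.1
    · exact fun h' => hc (by omega) h'.1

theorem exists_eq_opP_of_isOp {a : PrimeWord X} (h : a.IsOp) :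
    ∃ b : OpWord X, FreeSemigroup.of a = b.opP := by
  cases a with
  | var => exact h.elim
  | op b => exact ⟨b, rfl⟩

theorem HeadOp.exists_eq {a : OpWord X} (h : a.HeadOp) : ∃ b, a = opP b ∨ ∃ c, a = opP b * c := by
  induction a using induction_cons with
  | of a =>
    obtain ⟨b, hb⟩ := exists_eq_opP_of_isOp h
    exact ⟨b, .inl hb⟩
  | of_mul a c =>
    obtain ⟨b, hb⟩ := exists_eq_opP_of_isOp (a := a) h
    exact ⟨b, .inr ⟨c, by rw [hb]⟩⟩

theorem LastOp.exists_eq {a : OpWord X} (h : a.LastOp) : ∃ b, a = opP b ∨ ∃ c, a = c * opP b := by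
  induction a using induction_append with
  | var x => exact absurd h (lastOp_ofVar x)
  | op b => exact ⟨b, .inl rfl⟩
  | mul_var a x => simp at h
  | mul_op c b => exact ⟨b, .inr ⟨c, rfl⟩⟩

/-- If both factors of a product are free of adjacent pairs, the pair must sit at the junction;
otherwise it is found inside one factor. -/
theorem exists_mem_occurrences_of_not_noAdj {a : OpWord X} (ha : ¬ NoAdj a) :
    ∃ b c : OpWord X, a ∈ occurrences (b.opP * c.opP) := by
  induction a using induction_mul with
  | var x => simp at ha
  | op c ih =>
    obtain ⟨b, d, h⟩ := ih (by simpa using ha)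
    exact ⟨b, d, opP_mem_occurrences h⟩
  | mul a b iha ihb =>
    by_cases h1 : NoAdj a
    · by_cases h2 : NoAdj b
      · obtain ⟨h3, h4⟩ : a.LastOp ∧ b.HeadOp := by simpa [h1, h2] using ha
        obtain ⟨c, hc⟩ := h3.exists_eq
        obtain ⟨d, hd⟩ := h4.exists_eq
        refine ⟨c, d, ?_⟩
        have h := mem_occurrences_self (c.opP * d.opP)
        rcases hc with rfl | ⟨c', rfl⟩ <;> rcases hd with rfl | ⟨d', rfl⟩
        · exact h
        · simpa [mul_assoc] using mul_right_mem_occurrences d' h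
        · simpa [mul_assoc] using mul_left_mem_occurrences c' h
        · simpa [mul_assoc] using
            mul_left_mem_occurrences c' (mul_right_mem_occurrences d' h)
      · obtain ⟨c, d, h⟩ := ihb h2
        exact ⟨c, d, mul_left_mem_occurrences a h⟩
    · obtain ⟨c, d, h⟩ := iha h1
      exact ⟨c, d, mul_right_mem_occurrences b h⟩

end OpWord

/-! ### The set `Φ(X)` -/

open OpWord

section Words

variable {X : Type u}

theorem ofVar_mem_varWords (x : X) : ofVar x ∈ varWords X := ⟨FreeSemigroup.of x, rfl⟩

theorem mul_mem_varWords {a b : OpWord X} : a ∈ varWords X → b ∈ varWords X →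
    a * b ∈ varWords X := by
  rintro ⟨a, rfl⟩ ⟨b, rfl⟩
  exact ⟨a * b, map_mul _ a b⟩

theorem varWords_subset : varWords X ⊆ {a | NoAdj a ∧ ¬ a.HeadOp ∧ ¬ a.LastOp} := by
  rintro _ ⟨a, rfl⟩
  induction a using FreeSemigroup.recOnMul with
  | ih1 x => exact ⟨noAdj_ofVar x, headOp_ofVar x, lastOp_ofVar x⟩
  | ih2 x a hx ha =>
    rw [map_mul]
    simp only [Set.mem_ofPred_eq] at hx ha
    simp only [Set.mem_ofPred_eq, noAdj_mul, headOp_mul, lastOp_mul, hx, ha, not_false_eq_true,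
      and_self]

theorem setPow_mono {A B : Set (OpWord X)} (h : A ⊆ B) (n : ℕ) : setPow A n ⊆ setPow B n := by
  induction n with
  | zero => exact h
  | succ n ih => exact Set.mul_subset_mul ih h

/-- The elements of the alternating product that end with a factor from `Y`. -/
def altEndLeft (Y Z : Set (OpWord X)) : Set (OpWord X) :=
  (Y ∪ ⋃ n : ℕ, setPow (Y * OpWord.opP '' Z) n * Y) ∪ ⋃ n : ℕ, setPow (OpWord.opP '' Z * Y) n

/-- The elements of the alternating product that end with a factor from `P(Z)`. -/
def altEndOp (Y Z : Set (OpWord X)) : Set (OpWord X) :=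
  (⋃ n : ℕ, setPow (Y * OpWord.opP '' Z) n) ∪
    (OpWord.opP '' Z ∪ ⋃ n : ℕ, setPow (OpWord.opP '' Z * Y) n * OpWord.opP '' Z)

theorem altProd_eq (Y Z : Set (OpWord X)) : altProd Y Z = altEndLeft Y Z ∪ altEndOp Y Z := by
  ext a
  simp only [altProd, altEndLeft, altEndOp, Set.mem_union]
  tauto

theorem altEndLeft_mono (Y : Set (OpWord X)) {Z Z' : Set (OpWord X)} (h : Z ⊆ Z') :
    altEndLeft Y Z ⊆ altEndLeft Y Z' := by
  have h' := Set.image_mono (f := OpWord.opP) h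
  refine Set.union_subset_union (Set.union_subset_union_right _ ?_) ?_
  · exact Set.iUnion_mono fun n =>
      Set.mul_subset_mul_right (setPow_mono (Set.mul_subset_mul_left h') n)
  · exact Set.iUnion_mono fun n => setPow_mono (Set.mul_subset_mul_right h') n

theorem altEndOp_mono (Y : Set (OpWord X)) {Z Z' : Set (OpWord X)} (h : Z ⊆ Z') :
    altEndOp Y Z ⊆ altEndOp Y Z' := by
  have h' := Set.image_mono (f := OpWord.opP) h
  refine Set.union_subset_union ?_ (Set.union_subset_union h' ?_)
  · exact Set.iUnion_mono fun n => setPow_mono (Set.mul_subset_mul_left h') n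
  · exact Set.iUnion_mono fun n =>
      Set.mul_subset_mul (setPow_mono (Set.mul_subset_mul_right h') n) h'

theorem rbWordsAux_subset_succ (n : ℕ) : rbWordsAux X n ⊆ rbWordsAux X (n + 1) := by
  induction n with
  | zero =>
    intro a ha
    simp only [rbWordsAux, altProd_eq] at ha ⊢
    exact .inl (.inl (.inl ha))
  | succ n ih =>
    simp only [rbWordsAux, altProd_eq] at ih ⊢
    exact Set.union_subset_union (altEndLeft_mono _ ih) (altEndOp_mono _ ih)

theorem rbWordsAux_mono : Monotone (rbWordsAux X) := monotone_nat_of_le_succ rbWordsAux_subset_succ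

/-- `p` and `q` record whether each factor begins, respectively ends, with some P(·); `hpq` excludes
a bad junction between consecutive factors, and the product inherits the same end types. -/
theorem setPow_subset_noAdj {A : Set (OpWord X)} {p q : Prop} (hpq : ¬ (q ∧ p))
    (hA : A ⊆ {a | NoAdj a ∧ (a.HeadOp ↔ p) ∧ (a.LastOp ↔ q)}) (n : ℕ) :
    setPow A n ⊆ {a | NoAdj a ∧ (a.HeadOp ↔ p) ∧ (a.LastOp ↔ q)} := by
  induction n with
  | zero => exact hA
  | succ n ih =>
    rintro _ ⟨a, ha, b, hb, rfl⟩
    have ha := ih ha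
    have hb := hA hb
    simp only [Set.mem_ofPred_eq] at ha hb
    simp only [Set.mem_ofPred_eq, noAdj_mul, headOp_mul, lastOp_mul, ha, hb, true_and, and_self,
      and_true]
    exact hpq

theorem altProd_subset_noAdj {Z : Set (OpWord X)} (hZ : Z ⊆ {a | NoAdj a}) :
    altProd (varWords X) Z ⊆ {a | NoAdj a} := by
  have hP : OpWord.opP '' Z ⊆ {a | NoAdj a ∧ (a.HeadOp ↔ True) ∧ (a.LastOp ↔ True)} := by
    rintro _ ⟨a, ha, rfl⟩
    simpa using hZ ha
  have hY : varWords X ⊆ {a | NoAdj a ∧ (a.HeadOp ↔ False) ∧ (a.LastOp ↔ False)} := by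
    simpa only [iff_false] using varWords_subset (X := X)
  have hYP : varWords X * OpWord.opP '' Z ⊆
      {a | NoAdj a ∧ (a.HeadOp ↔ False) ∧ (a.LastOp ↔ True)} := by
    rintro _ ⟨a, ha, b, hb, rfl⟩
    have ha := hY ha
    have hb := hP hb
    simp only [Set.mem_ofPred_eq] at ha hb
    simp [ha, hb]
  have hPY : OpWord.opP '' Z * varWords X ⊆
      {a | NoAdj a ∧ (a.HeadOp ↔ True) ∧ (a.LastOp ↔ False)} := by
    rintro _ ⟨a, ha, b, hb, rfl⟩
    have ha := hP ha
    have hb := hY hb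
    simp only [Set.mem_ofPred_eq] at ha hb
    simp [ha, hb]
  have hYP' := setPow_subset_noAdj (by simp) hYP
  have hPY' := setPow_subset_noAdj (by simp) hPY
  refine Set.union_subset (Set.union_subset (Set.union_subset ?_ (Set.union_subset ?_ ?_)) ?_)
    (Set.union_subset ?_ ?_)
  · exact Set.iUnion_subset fun n a ha => (hYP' n ha).1
  · exact fun a ha => (hY ha).1
  · refine Set.iUnion_subset fun n => ?_
    rintro _ ⟨a, ha, b, hb, rfl⟩
    have ha := hYP' n ha
    have hb := hY hb
    simp only [Set.mem_ofPred_eq] at ha hb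
    simp [ha, hb]
  · exact Set.iUnion_subset fun n a ha => (hPY' n ha).1
  · exact fun a ha => (hP ha).1
  · refine Set.iUnion_subset fun n => ?_
    rintro _ ⟨a, ha, b, hb, rfl⟩
    have ha := hPY' n ha
    have hb := hP hb
    simp only [Set.mem_ofPred_eq] at ha hb
    simp [ha, hb]

theorem rbWordsAux_subset_noAdj (n : ℕ) : rbWordsAux X n ⊆ {a | NoAdj a} := by
  induction n with
  | zero => exact fun a ha => (varWords_subset ha).1
  | succ n ih => exact altProd_subset_noAdj ih

/-- A letter is absorbed by a final block of letters, or opens a new block after a final P(·); so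
every alternating word may be extended by it. -/
theorem mul_ofVar_mem_altEndLeft {Z : Set (OpWord X)} {a : OpWord X} (x : X)
    (ha : a ∈ altProd (varWords X) Z) : a * ofVar x ∈ altEndLeft (varWords X) Z := by
  have hx := ofVar_mem_varWords x
  rw [altProd_eq] at ha
  simp only [altEndLeft, altEndOp, Set.mem_union, Set.mem_iUnion] at ha ⊢
  rcases ha with ((ha | ⟨n, b, hb, c, hc, rfl⟩) | ⟨n, ha⟩) | (⟨n, ha⟩ | ha | ⟨n, b, hb, c, hc, rfl⟩)
  · exact .inl (.inl (mul_mem_varWords ha hx))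
  · refine .inl (.inr ⟨n, b, hb, c * ofVar x, mul_mem_varWords hc hx, (mul_assoc ..).symm⟩)
  · refine .inr ⟨n, ?_⟩
    -- Powers nest to the left: the factor P(z)y that absorbs the letter is the whole word for
    -- exponent 1 and the rightmost factor otherwise.
    cases n with
    | zero =>
      obtain ⟨b, hb, c, hc, rfl⟩ := ha
      exact ⟨b, hb, c * ofVar x, mul_mem_varWords hc hx, (mul_assoc ..).symm⟩
    | succ n =>
      obtain ⟨d, hd, _, ⟨b, hb, c, hc, rfl⟩, rfl⟩ := ha
      exact ⟨d, hd, b * (c * ofVar x), ⟨b, hb, _, mul_mem_varWords hc hx, rfl⟩,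
        by simp only [mul_assoc]⟩
  · exact .inl (.inr ⟨n, a, ha, _, hx, rfl⟩)
  · exact .inr ⟨0, a, ha, _, hx, rfl⟩
  · exact .inr ⟨n + 1, b, hb, _, ⟨c, hc, _, hx, rfl⟩, (mul_assoc ..).symm⟩

theorem mul_opP_mem_altEndOp {Z : Set (OpWord X)} {a c : OpWord X}
    (ha : a ∈ altEndLeft (varWords X) Z) (hc : c ∈ Z) :
    a * c.opP ∈ altEndOp (varWords X) Z := by
  have hx := Set.mem_image_of_mem OpWord.opP hc
  simp only [altEndLeft, altEndOp, Set.mem_union, Set.mem_iUnion] at ha ⊢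
  rcases ha with (ha | ⟨n, b, hb, d, hd, rfl⟩) | ⟨n, ha⟩
  · exact .inl ⟨0, a, ha, _, hx, rfl⟩
  · exact .inl ⟨n + 1, b, hb, _, ⟨d, hd, _, hx, rfl⟩, (mul_assoc ..).symm⟩
  · exact .inr (.inr ⟨n, a, ha, _, hx, rfl⟩)

/-- The second conjunct strengthens the induction: a factor P(c) may be appended only to a word
known to end in a block of letters. -/
theorem OpWord.NoAdj.exists_mem {a : OpWord X} (ha : NoAdj a) :
    ∃ n, a ∈ altProd (varWords X) (rbWordsAux X n) ∧
      (¬ a.LastOp → a ∈ altEndLeft (varWords X) (rbWordsAux X n)) := by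
  induction a using induction_append with
  | var x =>
    have h : ofVar x ∈ altEndLeft (varWords X) (rbWordsAux X 0) :=
      .inl (.inl (ofVar_mem_varWords x))
    exact ⟨0, by rw [altProd_eq]; exact .inl h, fun _ => h⟩
  | op c ih =>
    obtain ⟨n, hn, -⟩ := ih (by simpa using ha)
    refine ⟨n + 1, ?_, fun h => absurd (lastOp_opP c) h⟩
    rw [altProd_eq]
    exact .inr (.inr (.inl ⟨c, hn, rfl⟩))
  | mul_var a x ih =>
    obtain ⟨n, hn, -⟩ := ih ((noAdj_mul _ _).1 ha).1
    have h := mul_ofVar_mem_altEndLeft x hn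
    exact ⟨n, by rw [altProd_eq]; exact .inl h, fun _ => h⟩
  | mul_op a c iha ihc =>
    obtain ⟨h1, h2, h3⟩ := (noAdj_mul _ _).1 ha
    obtain ⟨n, -, hn⟩ := iha h1
    obtain ⟨m, hm, -⟩ := ihc (by simpa using h2)
    have hn := hn (by simpa using h3)
    -- The word `c` lies in Φ at level m + 1 and `a` alternates over level n; monotonicity brings
    -- both to a common level.
    refine ⟨max n (m + 1), ?_, fun h => absurd ((lastOp_mul _ _).2 (lastOp_opP c)) h⟩
    rw [altProd_eq]
    refine .inr (mul_opP_mem_altEndOp ?_ (rbWordsAux_mono (le_max_right n (m + 1)) hm))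
    exact altEndLeft_mono _ (rbWordsAux_mono (le_max_left n (m + 1))) hn

theorem mem_rbWords_iff {a : OpWord X} : a ∈ rbWords X ↔ NoAdj a := by
  refine ⟨fun h => ?_, fun h => ?_⟩
  · obtain ⟨n, hn⟩ := Set.mem_iUnion.1 h
    exact rbWordsAux_subset_noAdj n hn
  · obtain ⟨n, hn, -⟩ := NoAdj.exists_mem h
    exact Set.mem_iUnion.2 ⟨n + 1, hn⟩

end Words

/-! ### The leading words of the relations -/

section Leading

variable {K : Type v} [CommRing K] {X : Type u}

theorem OpWord.WtLT.length_le {r : X → X → Prop} {a b : OpWord X} (h : WtLT r a b) :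
    a.args.length ≤ b.args.length := by
  cases h with
  | count h => exact h.le
  | args p b₁ b₂ s₁ s₂ h₁ h₂ hs => simp [h₁, h₂, hs]
  | blocks h => rw [h]

/-- The Rota-Baxter relation for the words `a` and `b`. -/
noncomputable def rbRelation (lam : K) (a b : OpWord X) : OpAlg K X :=
  OpAlg.word K (a.opP * b.opP) - OpAlg.word K (a.opP * b).opP
    - OpAlg.word K (a * b.opP).opP - lam • OpAlg.word K (a * b).opP

theorem mul_ne_opP (a b c : OpWord X) : a * b ≠ c.opP := by
  intro h
  have := congrArg (fun a : OpWord X => a.tail.length) h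
  simp [OpWord.opP, FreeSemigroup.of] at this

/-- The first entry t of the weights decides the comparison: it is 2 for P(a)P(b) and 1 for all
other terms. No cancellation can remove P(a)P(b), since a proper product is never a single factor
P(e). -/
theorem isLeadingWord_rbRelation_iff [Nontrivial K] (r : X → X → Prop) (lam : K)
    (a b c : OpWord X) :
    OpAlg.IsLeadingWord (WtLT r) (rbRelation lam a b) c ↔ c = a.opP * b.opP := by
  have hmem : a.opP * b.opP ∈ (rbRelation lam a b).coeff.support := by
    simp [rbRelation, OpAlg.word, (mul_ne_opP _ _ _).symm]
  have hlen : (a.opP * b.opP).args.length = 2 := rfl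
  have hlt : ∀ d ∈ (rbRelation lam a b).coeff.support, d ≠ a.opP * b.opP → d.args.length = 1 := by
    intro d hd hne
    by_contra h
    have h' : ∀ e : OpWord X, e.opP ≠ d := by
      rintro e rfl
      exact h rfl
    simp [rbRelation, OpAlg.word, h', hne.symm] at hd
  constructor
  · rintro ⟨h1, h2⟩
    by_contra hne
    -- A different leading word would have t = 1 and yet lie above a word with t = 2.
    have := (h2 _ hmem (Ne.symm hne)).length_le
    rw [hlen, hlt c h1 hne] at this
    omega
  · rintro rfl
    refine ⟨hmem, fun d hd hne => .count ?_⟩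
    rw [hlen, hlt d hd hne]
    omega

theorem irr_rbRelations [Nontrivial K] (r : X → X → Prop) (lam : K) :
    OpAlg.Irr (WtLT r) (rbRelations lam X) = rbWords X := by
  ext a
  rw [mem_rbWords_iff]
  constructor
  · intro h
    by_contra ha
    obtain ⟨b, c, q, rfl⟩ := exists_mem_occurrences_of_not_noAdj ha
    exact h q _ ⟨b, c, rfl⟩ _ ((isLeadingWord_rbRelation_iff r lam b c _).2 rfl) rfl
  · rintro ha q _ ⟨b, c, rfl⟩ d hd rfl
    obtain rfl := (isLeadingWord_rbRelation_iff r lam b c _).1 hd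
    exact not_noAdj_of_mem_occurrences (by simp) ⟨q, rfl⟩ ha

end Leading

/-! ### The free algebra with one operator and its universal property -/

namespace OpAlg

variable {K : Type v} [CommRing K] {X : Type u}

theorem word_mul (a b : OpWord X) : word K (a * b) = word K a * word K b := by
  simp [word, MonoidAlgebra.single_mul_single]

@[simp] theorem opP_word (a : OpWord X) : opP K (word K a) = word K a.opP := by
  simp [opP, word]

/-- The words are a basis of `K⟨X;P⟩`. -/
noncomputable def wordBasis (K : Type v) [CommRing K] (X : Type u) :
    Module.Basis (OpWord X) K (OpAlg K X) := MonoidAlgebra.basis (OpWord X) K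

@[simp] theorem wordBasis_apply (a : OpWord X) : wordBasis K X a = word K a :=
  MonoidAlgebra.basis_apply K a

theorem linearMap_ext {M : Type*} [AddCommMonoid M] [Module K M] {f g : OpAlg K X →ₗ[K] M}
    (h : ∀ a, f (word K a) = g (word K a)) : f = g :=
  (wordBasis K X).ext fun a => by simpa using h a

/-- Induction for linear conditions on the elements of `K⟨X;P⟩`. -/
theorem induction_word {p : OpAlg K X → Prop} (word : ∀ a, p (word K a)) (zero : p 0)
    (add : ∀ f g, p f → p g → p (f + g)) (smul : ∀ (k : K) f, p f → p (k • f))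
    (f : OpAlg K X) : p f := by
  induction f using MonoidAlgebra.induction_linear with
  | zero => exact zero
  | add f g hf hg => exact add f g hf hg
  | single a k => simpa [OpAlg.word] using smul k _ (word a)

end OpAlg

-- Evaluation of words in an algebra with an operator

section Eval

variable {X : Type u} {A : Type w} [NonUnitalRing A]

mutual
  /-- The value of a prime word, with the letters `x` evaluated at `f x` and `P` at `Q`. -/
  def evalPrime (Q : A → A) (f : X → A) : PrimeWord X → A
    | .var x => f x
    | .op a => Q (evalWord Q f a)
  /-- The value of a word, with the letters `x` evaluated at `f x` and `P` at `Q`. -/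
  def evalWord (Q : A → A) (f : X → A) : FreeSemigroup (PrimeWord X) → A
    | ⟨a, l⟩ => evalList Q f (evalPrime Q f a) l
  /-- `z` times the value of the (possibly empty) list `l`. -/
  def evalList (Q : A → A) (f : X → A) (z : A) : List (PrimeWord X) → A
    | [] => z
    | a :: l => evalList Q f (z * evalPrime Q f a) l
end

variable (Q : A → A) (f : X → A)

theorem evalList_append (z : A) (l l' : List (PrimeWord X)) :
    evalList Q f z (l ++ l') = evalList Q f (evalList Q f z l) l' := by
  induction l generalizing z with
  | nil => simp [evalList]
  | cons b l ih => simp [evalList, ih]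

theorem evalList_mul (y z : A) (l : List (PrimeWord X)) :
    evalList Q f (y * z) l = y * evalList Q f z l := by
  induction l generalizing z with
  | nil => simp [evalList]
  | cons c l ih => simp [evalList, mul_assoc, ih]

@[simp] theorem evalWord_ofVar (x : X) : evalWord Q f (ofVar x) = f x := by
  simp [ofVar, FreeSemigroup.of, evalWord, evalPrime, evalList]

@[simp] theorem evalWord_opP (a : OpWord X) : evalWord Q f a.opP = Q (evalWord Q f a) := by
  simp [OpWord.opP, FreeSemigroup.of, evalWord, evalPrime, evalList]

theorem evalWord_mul (a b : OpWord X) :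
    evalWord Q f (a * b) = evalWord Q f a * evalWord Q f b := by
  obtain ⟨a, l⟩ := a
  obtain ⟨b, m⟩ := b
  change evalWord Q f ⟨a, l ++ b :: m⟩ = _
  simp only [evalWord, evalList_append, evalList, evalList_mul]

variable {K : Type v} [CommRing K] [Module K A] [IsScalarTower K A A] [SMulCommClass K A A]

/-- The homomorphism from `K⟨X;P⟩` to an algebra with operator that extends a map on `X`. -/
noncomputable def evalHom (Q : A →ₗ[K] A) (f : X → A) : OpAlg K X →ₙₐ[K] A :=
  MonoidAlgebra.liftMagma K ⟨evalWord Q f, evalWord_mul Q f⟩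

@[simp] theorem evalHom_word (Q : A →ₗ[K] A) (f : X → A) (a : OpWord X) :
    evalHom Q f (OpAlg.word K a) = evalWord Q f a := by
  simp [evalHom, OpAlg.word]

theorem evalHom_opP (Q : A →ₗ[K] A) (f : X → A) (a : OpAlg K X) :
    evalHom Q f (OpAlg.opP K a) = Q (evalHom Q f a) := by
  have h : (evalHom Q f : OpAlg K X →ₗ[K] A) ∘ₗ OpAlg.opP K =
      Q ∘ₗ (evalHom Q f : OpAlg K X →ₗ[K] A) := OpAlg.linearMap_ext fun a => by simp
  exact LinearMap.congr_fun h a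

/-- The kernel of evaluation is an operated ideal, and the identity for `Q` puts every relation in
it. -/
theorem evalHom_eq_zero {lam : K} {Q : A →ₗ[K] A} (hQ : IsRotaBaxter lam Q) (f : X → A)
    {a : OpAlg K X} (ha : a ∈ OpAlg.idSpan (rbRelations lam X)) : evalHom Q f a = 0 := by
  let I : Submodule K (OpAlg K X) := LinearMap.ker (evalHom Q f : OpAlg K X →ₗ[K] A)
  have hI : ∀ {b}, b ∈ I ↔ evalHom Q f b = 0 := LinearMap.mem_ker
  refine hI.1 ((Submodule.mem_sInf.1 ha) I ⟨⟨?_, ?_, ?_⟩, ?_⟩)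
  · intro b c hc
    rw [hI, map_mul, hI.1 hc, mul_zero]
  · intro b hb c
    rw [hI, map_mul, hI.1 hb, zero_mul]
  · intro b hb
    rw [hI, evalHom_opP, hI.1 hb, map_zero]
  · rintro _ ⟨b, c, rfl⟩
    change _ ∈ I
    rw [hI]
    simp only [map_sub, map_smul, evalHom_word, evalWord_mul, evalWord_opP, hQ _ _, map_add]
    abel

/-- The homomorphism from `K⟨X;P|S⟩` to a Rota-Baxter algebra that extends a map on `X`. -/
noncomputable def liftHom {lam : K} {Q : A →ₗ[K] A} (hQ : IsRotaBaxter lam Q) (f : X → A) :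
    OpQuot (rbRelations lam X) →ₙₐ[K] A :=
  let g : OpQuot (rbRelations lam X) →ₗ[K] A :=
    (OpAlg.idSpan (rbRelations lam X)).liftQ (evalHom Q f : OpAlg K X →ₗ[K] A)
      fun _ ha => evalHom_eq_zero hQ f ha
  { toFun := g
    map_smul' := g.map_smul
    map_zero' := g.map_zero
    map_add' := g.map_add
    map_mul' := fun a b => by
      obtain ⟨a, rfl⟩ := OpQuot.mk_surjective _ a
      obtain ⟨b, rfl⟩ := OpQuot.mk_surjective _ b
      exact map_mul (evalHom Q f) a b }

theorem liftHom_mk {lam : K} {Q : A →ₗ[K] A} (hQ : IsRotaBaxter lam Q) (f : X → A)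
    (a : OpAlg K X) : liftHom hQ f (OpQuot.mk _ a) = evalHom Q f a := rfl

end Eval

-- The universal property of the quotient

section Free

variable {K : Type v} [CommRing K] {X : Type u}

/-- It suffices to check the Rota-Baxter identity on a set of generators of the module. -/
theorem isRotaBaxter_of_surjective (lam : K) {R : Type w} [NonUnitalRing R] [Module K R]
    [IsScalarTower K R R] [SMulCommClass K R R] {P : R →ₗ[K] R} (π : OpAlg K X →ₗ[K] R)
    (hπ : Function.Surjective π)
    (h : ∀ a b, P (π (OpAlg.word K a)) * P (π (OpAlg.word K b)) =
      P (P (π (OpAlg.word K a)) * π (OpAlg.word K b) + π (OpAlg.word K a) * P (π (OpAlg.word K b))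
        + lam • (π (OpAlg.word K a) * π (OpAlg.word K b)))) : IsRotaBaxter lam P := by
  have key : ((LinearMap.mul K R).compl₁₂ (P ∘ₗ π) (P ∘ₗ π)) =
      ((LinearMap.mul K R).compl₁₂ (P ∘ₗ π) π + (LinearMap.mul K R).compl₁₂ π (P ∘ₗ π)
        + lam • (LinearMap.mul K R).compl₁₂ π π).compr₂ P :=
    OpAlg.linearMap_ext fun a => OpAlg.linearMap_ext fun b => by simpa using h a b
  intro x y
  obtain ⟨a, rfl⟩ := hπ x
  obtain ⟨b, rfl⟩ := hπ y
  simpa using LinearMap.congr_fun₂ key a b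

theorem isRotaBaxter_opQuot (lam : K) :
    IsRotaBaxter lam (OpQuot.opP (rbRelations lam X)) := by
  refine isRotaBaxter_of_surjective lam (OpQuot.mk _) (OpQuot.mk_surjective _) fun a b => ?_
  simp only [← OpQuot.mk_opP, ← OpQuot.mk_mul, ← map_add, ← map_smul]
  -- The difference of the two sides is the generator of S attached to `a` and `b`.
  refine (Submodule.Quotient.eq _).2 (Submodule.mem_sInf.2 fun I hI => hI.2 ⟨a, b, ?_⟩)
  simp only [map_add, map_smul, OpAlg.opP_word, ← OpAlg.word_mul]
  abel

theorem isFreeRotaBaxter_opQuot (lam : K) :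
    IsFreeRotaBaxter.{u, v, w} lam (OpQuot.opP (rbRelations lam X))
      (fun x : X => OpQuot.mk (rbRelations lam X) (OpAlg.word K (ofVar x))) := by
  refine ⟨isRotaBaxter_opQuot lam, fun A _ _ _ _ Q hQ f => ⟨liftHom hQ f, ⟨?_, ?_⟩, ?_⟩⟩
  · intro a
    obtain ⟨a, rfl⟩ := OpQuot.mk_surjective _ a
    rw [← OpQuot.mk_opP, liftHom_mk, liftHom_mk, evalHom_opP]
  · intro x
    rw [liftHom_mk, evalHom_word, evalWord_ofVar]
  · rintro φ ⟨h1, h2⟩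
    have h : (φ : OpQuot (rbRelations lam X) →ₗ[K] A) ∘ₗ OpQuot.mk _ = evalHom Q f := by
      refine OpAlg.linearMap_ext fun a => ?_
      change φ (OpQuot.mk _ (OpAlg.word K a)) = evalHom Q f (OpAlg.word K a)
      rw [evalHom_word]
      induction a using induction_mul with
      | var x => rw [h2, evalWord_ofVar]
      | op a ih => rw [← OpAlg.opP_word, OpQuot.mk_opP, h1, ih, evalWord_opP]
      | mul a b iha ihb => rw [OpAlg.word_mul, OpQuot.mk_mul, map_mul, iha, ihb, evalWord_mul]
    refine NonUnitalAlgHom.ext fun a => ?_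
    obtain ⟨a, rfl⟩ := OpQuot.mk_surjective _ a
    exact LinearMap.congr_fun h a

end Free

/-! ### The Rota-Baxter product of words -/

section Diamond

variable {K : Type v} [CommRing K] {X : Type u}

/-- `f` times the (possibly empty) list `l`. -/
noncomputable def mulList (f : OpAlg K X) : List (PrimeWord X) → OpAlg K X
  | [] => f
  | b :: l => f * OpAlg.word K ⟨b, l⟩

/-- The product of two words in the free Rota-Baxter algebra: it is the concatenation except
that the Rota-Baxter identity is used to multiply the last factor of the first word by the
first factor of the second one when both are of the form `P(c)`. -/
noncomputable def diamondWord (lam : K) : OpWord X → OpWord X → OpAlg K X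
  | ⟨a, a' :: l⟩, b => OpAlg.word K (FreeSemigroup.of a) * diamondWord lam ⟨a', l⟩ b
  | ⟨.op c, []⟩, ⟨.op d, l⟩ =>
    mulList (OpAlg.opP K (diamondWord lam ⟨.op c, []⟩ d + diamondWord lam c ⟨.op d, []⟩
      + lam • diamondWord lam c d)) l
  | ⟨.var x, []⟩, b => OpAlg.word K (ofVar x * b)
  | ⟨.op c, []⟩, ⟨.var x, l⟩ => OpAlg.word K (OpWord.opP c * ⟨.var x, l⟩)
termination_by a b => sizeOf a + sizeOf b
decreasing_by all_goals simp_wf; (try omega)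

/-- The bilinear extension of `diamondWord`. -/
noncomputable def diamond (lam : K) : OpAlg K X →ₗ[K] OpAlg K X →ₗ[K] OpAlg K X :=
  (OpAlg.wordBasis K X).constr K fun a => (OpAlg.wordBasis K X).constr K fun b =>
    diamondWord lam a b

@[simp] theorem diamond_word (lam : K) (a b : OpWord X) :
    diamond lam (OpAlg.word K a) (OpAlg.word K b) = diamondWord lam a b := by
  simp only [diamond, ← OpAlg.wordBasis_apply, Module.Basis.constr_basis]

end Diamond

section Diamond

variable {K : Type v} [CommRing K] {X : Type u} (lam : K)

theorem mulList_append (f : OpAlg K X) (l : List (PrimeWord X)) (a : OpWord X) :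
    mulList f (l ++ a.head :: a.tail) = mulList f l * OpAlg.word K a := by
  cases l with
  | nil => rfl
  | cons b l => rw [mulList, mul_assoc, ← OpAlg.word_mul]; rfl

/-- The product only touches the last factor of the left word, so the earlier factors come out by
concatenation; `diamondWord_mul_right` is the mirror image. -/
theorem diamondWord_mul_left (a b c : OpWord X) :
    diamondWord lam (a * b) c = OpAlg.word K a * diamondWord lam b c := by
  have key : ∀ (p : PrimeWord X) (b : OpWord X), diamondWord lam (FreeSemigroup.of p * b) c =
      OpAlg.word K (FreeSemigroup.of p) * diamondWord lam b c := by
    rintro p ⟨b, l⟩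
    rw [of_mul_mk, diamondWord]
  induction a using induction_cons with
  | of p => exact key p b
  | of_mul p a ih => rw [mul_assoc, key, ih, OpAlg.word_mul, mul_assoc]

theorem diamondWord_var_left (x : X) (a : OpWord X) :
    diamondWord lam (ofVar x) a = OpAlg.word K (ofVar x * a) := by
  rw [ofVar, FreeSemigroup.of, diamondWord]; rfl

theorem diamondWord_of_not {a b : OpWord X} (h : ¬ (a.LastOp ∧ b.HeadOp)) :
    diamondWord lam a b = OpAlg.word K (a * b) := by
  induction a using induction_cons with
  | of p =>
    obtain ⟨q, l⟩ := b
    cases p with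
    | var x => exact diamondWord_var_left lam x _
    | op c => cases q with
      | var y => rw [FreeSemigroup.of, diamondWord]; rfl
      | op d => exact absurd ⟨trivial, trivial⟩ h
  | of_mul p a ih =>
    rw [diamondWord_mul_left, ih (by simpa using h), ← OpAlg.word_mul, mul_assoc]

theorem diamondWord_opP (c d : OpWord X) :
    diamondWord lam c.opP d.opP = OpAlg.opP K (diamondWord lam c.opP d + diamondWord lam c d.opP
      + lam • diamondWord lam c d) := by
  simp only [opP, FreeSemigroup.of]
  rw [diamondWord, mulList]

theorem diamondWord_mul_right (a b c : OpWord X) :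
    diamondWord lam a (b * c) = diamondWord lam a b * OpAlg.word K c := by
  induction a using induction_cons with
  | of p =>
    obtain ⟨q, l⟩ := b
    by_cases h : p.IsOp ∧ q.IsOp
    · cases p with
      | var => exact h.1.elim
      | op a => cases q with
        | var => exact h.2.elim
        | op b =>
          change diamondWord lam ⟨_, []⟩ ⟨_, l ++ c.head :: c.tail⟩ = diamondWord lam ⟨_, []⟩ _ * _
          rw [diamondWord, diamondWord, mulList_append]
    · have h' : ¬ (LastOp (FreeSemigroup.of p) ∧ HeadOp ⟨q, l⟩) := h
      rw [diamondWord_of_not lam h', diamondWord_of_not lam (by simpa using h'), ← mul_assoc,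
        OpAlg.word_mul]
  | of_mul p a ih => rw [diamondWord_mul_left, diamondWord_mul_left, ih, mul_assoc]

-- Bilinear rules and associativity of the Rota-Baxter product

theorem diamond_mul_left (f g h : OpAlg K X) :
    diamond lam (f * g) h = f * diamond lam g h := by
  induction f using OpAlg.induction_word with
  | zero => simp
  | add f f' hf hf' => simp [add_mul, hf, hf']
  | smul k f hf => simp [hf, smul_mul_assoc]
  | word a =>
    induction g using OpAlg.induction_word with
    | zero => simp
    | add f f' hf hf' => simp [mul_add, hf, hf']
    | smul k f hf => simp [hf, mul_smul_comm]
    | word b =>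
      induction h using OpAlg.induction_word with
      | zero => simp
      | add f f' hf hf' => simp [mul_add, hf, hf']
      | smul k f hf => simp [hf, mul_smul_comm]
      | word c => rw [← OpAlg.word_mul, diamond_word, diamond_word, diamondWord_mul_left]

theorem diamond_mul_right (f g h : OpAlg K X) :
    diamond lam f (g * h) = diamond lam f g * h := by
  induction f using OpAlg.induction_word with
  | zero => simp
  | add f f' hf hf' => simp [add_mul, hf, hf']
  | smul k f hf => simp [hf, smul_mul_assoc]
  | word a =>
    induction g using OpAlg.induction_word with
    | zero => simp
    | add f f' hf hf' => simp [add_mul, hf, hf']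
    | smul k f hf => simp [hf, smul_mul_assoc]
    | word b =>
      induction h using OpAlg.induction_word with
      | zero => simp
      | add f f' hf hf' => simp [mul_add, hf, hf']
      | smul k f hf => simp [hf, mul_smul_comm]
      | word c => rw [← OpAlg.word_mul, diamond_word, diamond_word, diamondWord_mul_right]

theorem diamond_var_left (x : X) (f : OpAlg K X) :
    diamond lam (OpAlg.word K (ofVar x)) f = OpAlg.word K (ofVar x) * f := by
  induction f using OpAlg.induction_word with
  | zero => simp
  | add f f' hf hf' => simp [mul_add, hf, hf']
  | smul k f hf => simp [hf, mul_smul_comm]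
  | word a => rw [diamond_word, diamondWord_var_left, OpAlg.word_mul]

theorem diamond_var_right (x : X) (f : OpAlg K X) :
    diamond lam f (OpAlg.word K (ofVar x)) = f * OpAlg.word K (ofVar x) := by
  induction f using OpAlg.induction_word with
  | zero => simp
  | add f f' hf hf' => simp [add_mul, hf, hf']
  | smul k f hf => simp [hf, smul_mul_assoc]
  | word a => rw [diamond_word, diamondWord_of_not lam (by simp), OpAlg.word_mul]

theorem diamond_opP (f g : OpAlg K X) :
    diamond lam (OpAlg.opP K f) (OpAlg.opP K g) =
      OpAlg.opP K (diamond lam (OpAlg.opP K f) g + diamond lam f (OpAlg.opP K g)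
        + lam • diamond lam f g) := by
  have key : (diamond lam).compl₁₂ (OpAlg.opP K (X := X)) (OpAlg.opP K) =
      ((diamond lam).compl₁₂ (OpAlg.opP K) LinearMap.id +
        (diamond lam).compl₁₂ LinearMap.id (OpAlg.opP K) + lam • diamond lam).compr₂
        (OpAlg.opP K) :=
    OpAlg.linearMap_ext fun a => OpAlg.linearMap_ext fun b => by
      simpa using diamondWord_opP lam a b
  simpa using LinearMap.congr_fun₂ key f g

/-- The critical case of associativity. Expanding both sides leaves P applied to associators of
triples in which at least one of the three operators has been removed; the seven hypotheses are
these triples. -/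
theorem diamond_assoc_opP {f g h : OpAlg K X}
    (h₁ : diamond lam (diamond lam f g) h = diamond lam f (diamond lam g h))
    (h₂ : diamond lam (diamond lam (OpAlg.opP K f) g) h =
      diamond lam (OpAlg.opP K f) (diamond lam g h))
    (h₃ : diamond lam (diamond lam f (OpAlg.opP K g)) h =
      diamond lam f (diamond lam (OpAlg.opP K g) h))
    (h₄ : diamond lam (diamond lam f g) (OpAlg.opP K h) =
      diamond lam f (diamond lam g (OpAlg.opP K h)))
    (h₅ : diamond lam (diamond lam (OpAlg.opP K f) (OpAlg.opP K g)) h =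
      diamond lam (OpAlg.opP K f) (diamond lam (OpAlg.opP K g) h))
    (h₆ : diamond lam (diamond lam (OpAlg.opP K f) g) (OpAlg.opP K h) =
      diamond lam (OpAlg.opP K f) (diamond lam g (OpAlg.opP K h)))
    (h₇ : diamond lam (diamond lam f (OpAlg.opP K g)) (OpAlg.opP K h) =
      diamond lam f (diamond lam (OpAlg.opP K g) (OpAlg.opP K h))) :
    diamond lam (diamond lam (OpAlg.opP K f) (OpAlg.opP K g)) (OpAlg.opP K h) =
      diamond lam (OpAlg.opP K f) (diamond lam (OpAlg.opP K g) (OpAlg.opP K h)) := by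
  have hl := diamond_opP lam (diamond lam (OpAlg.opP K f) g + diamond lam f (OpAlg.opP K g)
    + lam • diamond lam f g) h
  have hr := diamond_opP lam f (diamond lam (OpAlg.opP K g) h + diamond lam g (OpAlg.opP K h)
    + lam • diamond lam g h)
  -- Folding the inner P(…) back into a product keeps the triple (P(f)P(g))h, and symmetrically
  -- f'(P(g)P(h)) with f' = P(f) or f, in the form required by `h₅` and `h₇`.
  rw [← diamond_opP] at hl hr
  rw [hl, hr]
  refine congrArg (OpAlg.opP K) ?_
  simp only [map_add, map_smul, LinearMap.add_apply, LinearMap.smul_apply, smul_add, h₁, h₂, h₃,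
    h₄, h₅, h₆, h₇]
  abel

theorem diamond_assoc_word (a b c : OpWord X) :
    diamond lam (diamond lam (OpAlg.word K a) (OpAlg.word K b)) (OpAlg.word K c) =
      diamond lam (OpAlg.word K a) (diamond lam (OpAlg.word K b) (OpAlg.word K c)) := by
  -- Outer factors of `a` and `c` come out on the left and right, which leaves single prime words at
  -- the two ends.
  induction hn : sizeOf a + sizeOf b + sizeOf c using Nat.strong_induction_on
    generalizing a b c with
  | _ n ih =>
  subst hn
  obtain ⟨p, l⟩ := a
  cases l with
  | cons p' l =>
    rw [← of_mul_mk, OpAlg.word_mul, diamond_mul_left, diamond_mul_left, diamond_mul_left]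
    rw [ih _ (by simp) ⟨p', l⟩ b c rfl]
  | nil =>
  obtain ⟨r, m⟩ := c
  cases m with
  | cons r' m =>
    rw [← of_mul_mk, OpAlg.word_mul, diamond_mul_right, diamond_mul_right, diamond_mul_right]
    have hr : 0 < sizeOf r' := by cases r' <;> simp
    rw [ih _ (by simp [FreeSemigroup.of]; omega) _ b (FreeSemigroup.of r) rfl]
  | nil =>
  obtain ⟨q, m⟩ := b
  cases m with
  | cons q' m =>
    -- A middle word of length at least two separates the junctions, so the two products do not
    -- interact.
    rw [← of_mul_mk, OpAlg.word_mul, diamond_mul_right, diamond_mul_left, diamond_mul_left,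
      diamond_mul_right]
  | nil =>
  cases p with
  | var x =>
    change diamond lam (diamond lam (OpAlg.word K (ofVar x)) _) _ =
      diamond lam (OpAlg.word K (ofVar x)) _
    rw [diamond_var_left, diamond_var_left, diamond_mul_left]
  | op a =>
  cases r with
  | var x =>
    change diamond lam _ (OpAlg.word K (ofVar x)) =
      diamond lam _ (diamond lam _ (OpAlg.word K (ofVar x)))
    rw [diamond_var_right, diamond_var_right, diamond_mul_right]
  | op c =>
  cases q with
  | var x =>
    change diamond lam (diamond lam _ (OpAlg.word K (ofVar x))) _ =
      diamond lam _ (diamond lam (OpAlg.word K (ofVar x)) _)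
    rw [diamond_var_right, diamond_var_left, diamond_mul_left, diamond_mul_right,
      diamond_var_left, diamond_var_right, mul_assoc]
  | op b =>
  change diamond lam (diamond lam (OpAlg.word K (opP a)) (OpAlg.word K (opP b)))
      (OpAlg.word K (opP c)) = diamond lam (OpAlg.word K (opP a))
      (diamond lam (OpAlg.word K (opP b)) (OpAlg.word K (opP c)))
  have s : ∀ a : OpWord X, sizeOf a < sizeOf (⟨.op a, []⟩ : OpWord X) := fun a => by simp; omega
  have ha := s a
  have hb := s b
  have hc := s c
  have h1 := ih _ (by omega) a b c rfl
  have h2 := ih _ (by omega) ⟨.op a, []⟩ b c rfl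
  have h3 := ih _ (by omega) a ⟨.op b, []⟩ c rfl
  have h4 := ih _ (by omega) a b ⟨.op c, []⟩ rfl
  have h5 := ih _ (by omega) ⟨.op a, []⟩ ⟨.op b, []⟩ c rfl
  have h6 := ih _ (by omega) ⟨.op a, []⟩ b ⟨.op c, []⟩ rfl
  have h7 := ih _ (by omega) a ⟨.op b, []⟩ ⟨.op c, []⟩ rfl
  have e : ∀ a : OpWord X, OpAlg.word K ⟨.op a, []⟩ = OpAlg.opP K (OpAlg.word K a) :=
    fun a => (OpAlg.opP_word a).symm
  simp only [e] at h2 h3 h4 h5 h6 h7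
  simp only [← OpAlg.opP_word]
  exact diamond_assoc_opP lam h1 h2 h3 h4 h5 h6 h7

theorem diamond_assoc (f g h : OpAlg K X) :
    diamond lam (diamond lam f g) h = diamond lam f (diamond lam g h) := by
  induction f using OpAlg.induction_word with
  | zero => simp
  | add f f' hf hf' => simp [-diamond_word, hf, hf']
  | smul k f hf => simp [-diamond_word, hf]
  | word a =>
    induction g using OpAlg.induction_word with
    | zero => simp
    | add f f' hf hf' => simp [-diamond_word, hf, hf']
    | smul k f hf => simp [-diamond_word, hf]
    | word b =>
      induction h using OpAlg.induction_word with
      | zero => simp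
      | add f f' hf hf' => simp [-diamond_word, hf, hf']
      | smul k f hf => simp [-diamond_word, hf]
      | word c => exact diamond_assoc_word lam a b c

/-! ### The Rota-Baxter algebra given by this product -/

/-- The module `K⟨X;P⟩`, with the Rota-Baxter product as multiplication. -/
def DiamondAlg {K : Type v} [CommRing K] (_ : K) (X : Type u) : Type (max u v) := OpAlg K X

namespace DiamondAlg

noncomputable instance : AddCommGroup (DiamondAlg lam X) :=
  inferInstanceAs (AddCommGroup (OpAlg K X))

noncomputable instance : Module K (DiamondAlg lam X) := inferInstanceAs (Module K (OpAlg K X))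

/-- The identity map from `K⟨X;P⟩`. -/
noncomputable def mk : OpAlg K X ≃ₗ[K] DiamondAlg lam X := LinearEquiv.refl K (OpAlg K X)

noncomputable instance : Mul (DiamondAlg lam X) :=
  ⟨fun a b => mk lam (diamond lam ((mk lam).symm a) ((mk lam).symm b))⟩

noncomputable instance : NonUnitalRing (DiamondAlg lam X) where
  left_distrib a b c := (diamond lam a).map_add b c
  right_distrib a b c := LinearMap.map_add₂ (diamond lam) a b c
  zero_mul a := LinearMap.map_zero₂ (diamond lam) a
  mul_zero a := (diamond lam a).map_zero
  mul_assoc := diamond_assoc lam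

instance : IsScalarTower K (DiamondAlg lam X) (DiamondAlg lam X) :=
  ⟨fun k a b => LinearMap.map_smul₂ (diamond lam) k a b⟩

instance : SMulCommClass K (DiamondAlg lam X) (DiamondAlg lam X) :=
  ⟨fun k a b => ((diamond lam a).map_smul k b).symm⟩

/-- The operator of `K⟨X;P⟩`. -/
noncomputable def opP : DiamondAlg lam X →ₗ[K] DiamondAlg lam X := OpAlg.opP K

theorem isRotaBaxter : IsRotaBaxter lam (opP lam (X := X)) := fun a b => diamond_opP lam a b

end DiamondAlg

/-! ### Normal forms -/

/-- The normal form, as a linear map on `K⟨X;P|S⟩`. -/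
noncomputable def normalForm (X : Type u) : OpQuot (rbRelations lam X) →ₗ[K] OpAlg K X :=
  (DiamondAlg.mk lam).symm.toLinearMap ∘ₗ
    ((liftHom (DiamondAlg.isRotaBaxter lam (X := X))
      fun x : X => DiamondAlg.mk lam (OpAlg.word K (ofVar x)) :
        OpQuot (rbRelations lam X) →ₙₐ[K] DiamondAlg lam X) :
      OpQuot (rbRelations lam X) →ₗ[K] DiamondAlg lam X)

theorem normalForm_ofVar (x : X) :
    normalForm lam X (OpQuot.mk _ (OpAlg.word K (ofVar x))) = OpAlg.word K (ofVar x) := by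
  change (DiamondAlg.mk lam).symm (liftHom (DiamondAlg.isRotaBaxter lam) _ _) = _
  rw [liftHom_mk, evalHom_word, evalWord_ofVar, LinearEquiv.symm_apply_apply]

theorem normalForm_opP (a : OpQuot (rbRelations lam X)) :
    normalForm lam X (OpQuot.opP _ a) = OpAlg.opP K (normalForm lam X a) := by
  obtain ⟨a, rfl⟩ := OpQuot.mk_surjective _ a
  exact evalHom_opP (DiamondAlg.opP lam) (fun x => DiamondAlg.mk lam (OpAlg.word K (ofVar x))) a

theorem normalForm_mul (a b : OpQuot (rbRelations lam X)) :
    normalForm lam X (a * b) = diamond lam (normalForm lam X a) (normalForm lam X b) :=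
  map_mul (liftHom (DiamondAlg.isRotaBaxter lam)
    fun x => DiamondAlg.mk lam (OpAlg.word K (ofVar x))) a b

/-- A `NoAdj` word is a product with no P(·)P(·) junction, and at such junctions the Rota-Baxter
product is concatenation. -/
theorem normalForm_word {a : OpWord X} (ha : NoAdj a) :
    normalForm lam X (OpQuot.mk _ (OpAlg.word K a)) = OpAlg.word K a := by
  induction a using induction_mul with
  | var x => exact normalForm_ofVar lam x
  | op a ih =>
    rw [← OpAlg.opP_word, OpQuot.mk_opP, normalForm_opP, ih (by simpa using ha)]
  | mul a b iha ihb =>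
    obtain ⟨h1, h2, h3⟩ := (noAdj_mul a b).1 ha
    rw [OpAlg.word_mul, OpQuot.mk_mul, normalForm_mul, iha h1, ihb h2, diamond_word,
      diamondWord_of_not lam h3, OpAlg.word_mul]

-- Spanning by words without adjacent operators

/-- The span of the images in `K⟨X;P|S⟩` of the words in `s`. -/
noncomputable def wordSpan (s : Set (OpWord X)) : Submodule K (OpQuot (rbRelations lam X)) :=
  Submodule.span K ((fun a => OpQuot.mk _ (OpAlg.word K a)) '' s)

theorem mk_word_mem_wordSpan {s : Set (OpWord X)} {a : OpWord X} (ha : a ∈ s) :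
    OpQuot.mk _ (OpAlg.word K a) ∈ wordSpan lam s :=
  Submodule.subset_span ⟨a, ha, rfl⟩

theorem wordSpan_mono {s t : Set (OpWord X)} (h : s ⊆ t) : wordSpan lam s ≤ wordSpan lam t :=
  Submodule.span_mono (Set.image_mono h)

theorem map_mem_of_mem_wordSpan {s : Set (OpWord X)}
    {I : Submodule K (OpQuot (rbRelations lam X))}
    (φ : OpQuot (rbRelations lam X) →ₗ[K] OpQuot (rbRelations lam X))
    (h : ∀ a ∈ s, φ (OpQuot.mk _ (OpAlg.word K a)) ∈ I) {f : OpQuot (rbRelations lam X)}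
    (hf : f ∈ wordSpan lam s) : φ f ∈ I := by
  have : wordSpan lam s ≤ I.comap φ := Submodule.span_le.2 (by rintro _ ⟨a, ha, rfl⟩; exact h a ha)
  exact this hf

theorem opP_mem_wordSpan {f : OpQuot (rbRelations lam X)} (hf : f ∈ wordSpan lam {a | NoAdj a}) :
    OpQuot.opP _ f ∈ wordSpan lam {a | NoAdj a ∧ a.HeadOp ∧ a.LastOp} := by
  refine map_mem_of_mem_wordSpan lam (OpQuot.opP _) (fun a ha => ?_) hf
  rw [← OpQuot.mk_opP, OpAlg.opP_word]
  exact mk_word_mem_wordSpan lam (by simpa using ha)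

/-- The types of the first and last factors are tracked so that, after a junction has been
rewritten, the remaining factors can be put back without creating new adjacent pairs. -/
theorem mk_word_mul_mem_wordSpan {a b : OpWord X} (ha : NoAdj a) (hb : NoAdj b) :
    OpQuot.mk _ (OpAlg.word K a) * OpQuot.mk _ (OpAlg.word K b) ∈
      wordSpan lam {c | NoAdj c ∧ (c.HeadOp ↔ a.HeadOp) ∧ (c.LastOp ↔ b.LastOp)} := by
  induction hn : sizeOf a + sizeOf b using Nat.strong_induction_on generalizing a b with
  | _ n ih =>
  subst hn
  by_cases h : a.LastOp ∧ b.HeadOp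
  swap
  · rw [← OpQuot.mk_mul, ← OpAlg.word_mul]
    exact mk_word_mem_wordSpan lam (by simp [ha, hb, h])
  obtain ⟨p, l⟩ := a
  cases l with
  | cons p' l =>
    rw [← of_mul_mk] at ha h ⊢
    obtain ⟨h1, h2, h3⟩ := (noAdj_mul _ _).1 ha
    rw [OpAlg.word_mul, OpQuot.mk_mul, mul_assoc]
    refine map_mem_of_mem_wordSpan lam
      (LinearMap.mulLeft K (OpQuot.mk _ (OpAlg.word K (FreeSemigroup.of p)))) (fun c hc => ?_)
      (ih _ (by simp) h2 hb rfl)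
    rw [LinearMap.mulLeft_apply, ← OpQuot.mk_mul, ← OpAlg.word_mul]
    refine mk_word_mem_wordSpan lam ?_
    simp only [Set.mem_ofPred_eq] at hc
    simp only [Set.mem_ofPred_eq, noAdj_mul, headOp_mul, lastOp_mul, hc, h1, h3,
      not_false_eq_true, and_self]
  | nil =>
  obtain ⟨q, m⟩ := b
  cases m with
  | cons q' m =>
    rw [← of_mul_mk] at hb h ⊢
    obtain ⟨h1, h2, h3⟩ := (noAdj_mul _ _).1 hb
    have hq : 0 < sizeOf q' := by cases q' <;> simp
    rw [OpAlg.word_mul, OpQuot.mk_mul, ← mul_assoc]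
    refine map_mem_of_mem_wordSpan lam
      (LinearMap.mulRight K (OpQuot.mk _ (OpAlg.word K ⟨q', m⟩))) (fun c hc => ?_)
      (ih _ (by simp [FreeSemigroup.of]; omega) ha h1 rfl)
    rw [LinearMap.mulRight_apply, ← OpQuot.mk_mul, ← OpAlg.word_mul]
    refine mk_word_mem_wordSpan lam ?_
    simp only [Set.mem_ofPred_eq] at hc
    simp only [Set.mem_ofPred_eq, noAdj_mul, headOp_mul, lastOp_mul, hc, h2, h3,
      not_false_eq_true, and_self]
  | nil =>
  cases p with
  | var => exact h.1.elim
  | op a => cases q with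
    | var => exact h.2.elim
    | op b =>
      have hs : ∀ a : OpWord X, sizeOf a < sizeOf (⟨.op a, []⟩ : OpWord X) :=
        fun a => by simp; omega
      have h1 := hs a
      have h2 := hs b
      have ha' : NoAdj a := (noAdj_opP a).1 ha
      have hb' : NoAdj b := (noAdj_opP b).1 hb
      have mono : ∀ p q : OpWord X → Prop,
          wordSpan lam {a | NoAdj a ∧ p a ∧ q a} ≤ wordSpan lam {a | NoAdj a} :=
        fun _ _ => wordSpan_mono lam fun a ha => ha.1
      change OpQuot.mk _ (OpAlg.word K (opP a)) * OpQuot.mk _ (OpAlg.word K (opP b)) ∈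
        wordSpan lam {c | NoAdj c ∧ (c.HeadOp ↔ (opP a).HeadOp) ∧ (c.LastOp ↔ (opP b).LastOp)}
      simp only [headOp_opP, lastOp_opP, iff_true]
      -- The Rota-Baxter identity in the quotient leaves P of three products, each of smaller total
      -- size.
      rw [← OpAlg.opP_word, ← OpAlg.opP_word, OpQuot.mk_opP, OpQuot.mk_opP,
        isRotaBaxter_opQuot lam]
      refine opP_mem_wordSpan lam (Submodule.add_mem _ (Submodule.add_mem _ ?_ ?_)
        (Submodule.smul_mem _ _ ?_))
      · rw [← OpQuot.mk_opP, OpAlg.opP_word]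
        exact mono _ _ (ih _ (a := ⟨.op a, []⟩) (b := b) (by omega) ha hb' rfl)
      · rw [← OpQuot.mk_opP, OpAlg.opP_word]
        exact mono _ _ (ih _ (a := a) (b := ⟨.op b, []⟩) (by omega) ha' hb rfl)
      · exact mono _ _ (ih _ (by omega) ha' hb' rfl)

theorem mul_mem_wordSpan {f g : OpQuot (rbRelations lam X)}
    (hf : f ∈ wordSpan lam {a | NoAdj a}) (hg : g ∈ wordSpan lam {a | NoAdj a}) :
    f * g ∈ wordSpan lam {a | NoAdj a} := by
  refine map_mem_of_mem_wordSpan lam (LinearMap.mulRight K g) (fun a ha => ?_) hf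
  refine map_mem_of_mem_wordSpan lam (LinearMap.mulLeft K _) (fun b hb => ?_) hg
  exact wordSpan_mono lam (fun c hc => hc.1) (mk_word_mul_mem_wordSpan lam ha hb)

theorem wordSpan_noAdj : wordSpan lam {a : OpWord X | NoAdj a} = ⊤ := by
  refine (Submodule.eq_top_iff').2 fun f => ?_
  obtain ⟨f, rfl⟩ := OpQuot.mk_surjective _ f
  induction f using OpAlg.induction_word with
  | zero => simp
  | add f g hf hg => rw [map_add]; exact Submodule.add_mem _ hf hg
  | smul k f hf => rw [map_smul]; exact Submodule.smul_mem _ k hf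
  | word a =>
    induction a using induction_mul with
    | var x => exact mk_word_mem_wordSpan lam (noAdj_ofVar x)
    | op a ih =>
      rw [← OpAlg.opP_word, OpQuot.mk_opP]
      exact wordSpan_mono lam (fun c hc => hc.1) (opP_mem_wordSpan lam ih)
    | mul a b iha ihb =>
      rw [OpAlg.word_mul, OpQuot.mk_mul]
      exact mul_mem_wordSpan lam iha ihb

-- Linear independence and the basis

theorem linearIndependent_rbWords :
    LinearIndependent K fun a : rbWords X => OpQuot.mk (rbRelations lam X) (OpAlg.word K a.1) := by
  refine LinearIndependent.of_comp (normalForm lam X) ?_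
  have h : (normalForm lam X ∘ fun a : rbWords X =>
      OpQuot.mk (rbRelations lam X) (OpAlg.word K a.1)) =
      OpAlg.wordBasis K X ∘ Subtype.val := by
    funext a
    rw [Function.comp_apply, normalForm_word lam (mem_rbWords_iff.1 a.2)]
    exact (OpAlg.wordBasis_apply a.1).symm
  rw [h]
  exact (OpAlg.wordBasis K X).linearIndependent.comp _ Subtype.val_injective

theorem span_rbWords :
    Submodule.span K (Set.range fun a : rbWords X =>
      OpQuot.mk (rbRelations lam X) (OpAlg.word K a.1)) = ⊤ := by
  rw [← wordSpan_noAdj lam, wordSpan]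
  congr 1
  ext f
  simp [mem_rbWords_iff]

/-- The images of the Rota-Baxter words form a basis of `K⟨X;P|S⟩`. -/
noncomputable def rbBasis (X : Type u) : Module.Basis (rbWords X) K (OpQuot (rbRelations lam X)) :=
  Module.Basis.mk (linearIndependent_rbWords lam) (span_rbWords lam).ge

theorem rbBasis_apply (a : rbWords X) :
    rbBasis lam X a = OpQuot.mk (rbRelations lam X) (OpAlg.word K a.1) :=
  Module.Basis.mk_apply _ _ a

end Diamond

end RotaBaxter

theorem mainTheorem3 {K : Type v} [CommRing K] [Nontrivial K] (lam : K) (X : Type u) :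
    (∀ (r : X → X → Prop) [IsWellOrder X r],
      RotaBaxter.OpAlg.Irr (RotaBaxter.OpWord.WtLT r) (RotaBaxter.rbRelations lam X) =
        RotaBaxter.rbWords X) ∧
    (∃ B : Module.Basis (RotaBaxter.rbWords X) K
        (RotaBaxter.OpQuot (RotaBaxter.rbRelations lam X)),
      ∀ a : RotaBaxter.rbWords X,
        B a = RotaBaxter.OpQuot.mk (RotaBaxter.rbRelations lam X)
          (RotaBaxter.OpAlg.word K a.1)) ∧
    RotaBaxter.IsFreeRotaBaxter.{u, v, w} lam
      (RotaBaxter.OpQuot.opP (RotaBaxter.rbRelations lam X))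
      (fun x : X => RotaBaxter.OpQuot.mk (RotaBaxter.rbRelations lam X)
        (RotaBaxter.OpAlg.word K (RotaBaxter.OpWord.ofVar x))) :=
  ⟨fun r _ => RotaBaxter.irr_rbRelations r lam,
    ⟨RotaBaxter.rbBasis lam X, RotaBaxter.rbBasis_apply lam⟩,
    RotaBaxter.isFreeRotaBaxter_opQuot lam⟩
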